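/- Let $k$ be a field with $\operatorname{char} k\neq 2,3$, let $\Gamma$ be a commutative group, and let $\varepsilon:\Gamma\times\Gamma\to k\setminus\{0\}$ be a commutation factor, i.e. $\varepsilon(\alpha+\beta,\gamma)=\varepsilon(\alpha,\gamma)\varepsilon(\beta,\gamma)$, $\varepsilon(\alpha,\beta+\gamma)=\varepsilon(\alpha,\beta)\varepsilon(\alpha,\gamma)$ and $\varepsilon(\alpha,\beta)\varepsilon(\beta,\alpha)=1$ for all $\alpha,\beta,\gamma\in\Gamma$. A color Lie algebra is a $\Gamma$-graded vector space $g=\bigoplus_{\gamma}g_\gamma$ over $k$ with a bilinear bracket such that $\langle g_\alpha,g_\beta\rangle\subseteq g_{\alpha+\beta}$, $\langle a,b\rangle=-\varepsilon(\alpha,\beta)\langle b,a\rangle$ and $$\varepsilon(\gamma,\alpha)\langle a,\langle b,c\rangle\rangle+\varepsilon(\beta,\gamma)\langle c,\langle a,b\rangle\rangle+\varepsilon(\alpha,\beta)\langle b,\langle c,a\rangle\rangle=0$$ for all $a\in g_\alpha$, $b\in g_\beta$, $c\in g_\gamma$. It is abelian if its bracket is zero. Its universal enveloping algebra $U(g)$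 is the quotient of the tensor algebra $T(g)$ by the two-sided ideal generated by the elements $ab-\varepsilon(\alpha,\beta)ba-\langle a,b\rangle$ with $a\in g_\alpha$, $b\in g_\beta$; it is augmented by the algebra homomorphism $U(g)\to k$ that sends $g$ to $0$. The homology of $g$ (with trivial coefficients) is $H_i(g)=\operatorname{Tor}_i^{U(g)}(k,k)$, $i\ge 0$. Let $g$ be an $n$-dimensional abelian color Lie algebra with a basis $v_1,\dots,v_n$ of homogeneous elements, $v_i\in g_{d_i}$, and let $q$ be the number of indices $i$ with $\varepsilon(d_i,d_i)=-1$ (that is, the number of generators $v_i$ whose square is a defining relation of $U(g)$). Then every $H_i(g)$ is finite-dimensional and $$\sum_{i=0}^\infty z^i\dim_k H_i(g)=\frac{(1+z)^{n-q}}{(1-z)^q}$$ as formal power series. In particular, the total homology $\bigoplus_{i\ge 0}H_i(g)$ is finite-dimensional if and only if $q=0$. -/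

import Mathlib

open CategoryTheory
open scoped TensorProduct ModuleCat

universe u v w

noncomputable section

/-! ### Color Lie algebras -/

/-- A commutation factor on the commutative group `Γ` with values in `k ∖ {0}`. -/
structure CommutationFactor (k : Type u) [Field k] (Γ : Type v) [AddCommGroup Γ] where
  toFun : Γ → Γ → kˣ
  add_left : ∀ α β γ, toFun (α + β) γ = toFun α γ * toFun β γ
  add_right : ∀ α β γ, toFun α (β + γ) = toFun α β * toFun α γ
  mul_swap : ∀ α β, toFun α β * toFun β α = 1

/-- The value `ε(α, β)`, as an element of the field `k`. -/
def CommutationFactor.val {k : Type u} [Field k] {Γ : Type v} [AddCommGroup Γ]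
    (ε : CommutationFactor k Γ) (α β : Γ) : k :=
  (ε.toFun α β : k)

open Classical in
/-- A color Lie algebra (a `Γ`-graded `ε`-Lie algebra) structure on the vector space `g`. -/
structure ColorLieAlgebra {k : Type u} [Field k] {Γ : Type v} [AddCommGroup Γ]
    (ε : CommutationFactor k Γ) (g : Type w) [AddCommGroup g] [Module k g] where
  /-- The homogeneous components. -/
  component : Γ → Submodule k g
  /-- `g` is the direct sum of its homogeneous components. -/
  isInternal : DirectSum.IsInternal component
  /-- The bilinear bracket. -/
  bracket : g →ₗ[k] g →ₗ[k] g
  bracket_mem : ∀ (α β : Γ), ∀ a ∈ component α, ∀ b ∈ component β,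
    bracket a b ∈ component (α + β)
  skew : ∀ (α β : Γ), ∀ a ∈ component α, ∀ b ∈ component β,
    bracket a b = -(ε.val α β • bracket b a)
  jacobi : ∀ (α β γ : Γ), ∀ a ∈ component α, ∀ b ∈ component β, ∀ c ∈ component γ,
    ε.val γ α • bracket a (bracket b c) + ε.val β γ • bracket c (bracket a b)
      + ε.val α β • bracket b (bracket c a) = 0

namespace ColorLieAlgebra

variable {k : Type u} [Field k] {Γ : Type v} [AddCommGroup Γ] {ε : CommutationFactor k Γ}
  {g : Type w} [AddCommGroup g] [Module k g]

/-- A color Lie algebra is abelian if its bracket vanishes. -/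
def IsAbelian (L : ColorLieAlgebra ε g) : Prop :=
  ∀ x y : g, L.bracket x y = 0

/-- The defining relations `ab - ε(α, β) ba = ⟨a, b⟩` of the universal enveloping algebra,
for homogeneous elements `a` of degree `α` and `b` of degree `β`. -/
inductive EnvelopingRel (L : ColorLieAlgebra ε g) : TensorAlgebra k g → TensorAlgebra k g → Prop
  | of (α β : Γ) (a b : g) (ha : a ∈ L.component α) (hb : b ∈ L.component β) :
      EnvelopingRel L
        (TensorAlgebra.ι k a * TensorAlgebra.ι k b
          - ε.val α β • (TensorAlgebra.ι k b * TensorAlgebra.ι k a))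
        (TensorAlgebra.ι k (L.bracket a b))

/-- The universal enveloping algebra `U(g)`: the quotient of the tensor algebra of `g` by the
two-sided ideal generated by the relations `EnvelopingRel`. -/
abbrev Enveloping (L : ColorLieAlgebra ε g) : Type (max u w) :=
  RingQuot L.EnvelopingRel

/-- The augmentation `U(g) → k`, which sends every element of `g` to `0`. -/
def augmentation (L : ColorLieAlgebra ε g) : L.Enveloping →ₐ[k] k :=
  RingQuot.liftAlgHom k
    ⟨TensorAlgebra.lift k (0 : g →ₗ[k] k), by
      rintro _ _ ⟨α, β, a, b, ha, hb⟩
      simp⟩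

end ColorLieAlgebra

/-! ### `Tor` over a noncommutative algebra -/

/-- The subspace of `M ⊗_k N` spanned by the elements `(m a) ⊗ n - m ⊗ (a n)`. -/
def balancedRelations (k : Type u) [Field k] (A : Type v) [Ring A] [Algebra k A]
    (M : Type w) [AddCommGroup M] [Module k M] [Module Aᵐᵒᵖ M]
    (N : Type*) [AddCommGroup N] [Module k N] [Module A N] : Submodule k (M ⊗[k] N) :=
  Submodule.span k
    {t | ∃ (m : M) (a : A) (n : N), t = (MulOpposite.op a • m) ⊗ₜ[k] n - m ⊗ₜ[k] (a • n)}

/-- The tensor product `M ⊗_A N` of a right `A`-module `M` and a left `A`-module `N`, for an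
algebra `A` over the field `k`. -/
abbrev BalancedTensor (k : Type u) [Field k] (A : Type v) [Ring A] [Algebra k A]
    (M : Type w) [AddCommGroup M] [Module k M] [Module Aᵐᵒᵖ M]
    (N : Type*) [AddCommGroup N] [Module k N] [Module A N] :=
  (M ⊗[k] N) ⧸ balancedRelations k A M N

/-- The map `M ⊗_A N → M ⊗_A N'` induced by an `A`-linear map `N → N'`. -/
def BalancedTensor.map (k : Type u) [Field k] (A : Type v) [Ring A] [Algebra k A]
    (M : Type w) [AddCommGroup M] [Module k M] [Module Aᵐᵒᵖ M]
    {N N' : Type*} [AddCommGroup N] [Module k N] [Module A N] [IsScalarTower k A N]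
    [AddCommGroup N'] [Module k N'] [Module A N'] [IsScalarTower k A N']
    (f : N →ₗ[A] N') : BalancedTensor k A M N →ₗ[k] BalancedTensor k A M N' :=
  Submodule.mapQ _ _ ((f.restrictScalars k).lTensor M) <| by
    rw [balancedRelations, Submodule.span_le]
    rintro _ ⟨m, a, n, rfl⟩
    exact Submodule.subset_span ⟨m, a, f n, by simp⟩

/-- The functor `M ⊗_A -` from left `A`-modules to `k`-vector spaces, for a right `A`-module `M`
on which `k` acts through `A`. -/
def balancedTensorFunctor (k : Type u) [Field k] (A : Type u) [Ring A] [Algebra k A]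
    (M : Type u) [AddCommGroup M] [Module k M] [Module Aᵐᵒᵖ M] [IsScalarTower k Aᵐᵒᵖ M] :
    ModuleCat.{u} A ⥤ ModuleCat.{u} k where
  obj N := ModuleCat.of k (BalancedTensor k A M N)
  map f := ModuleCat.ofHom (BalancedTensor.map k A M f.hom)
  map_id N := by
    ext : 1
    refine Submodule.linearMap_qext _ (TensorProduct.ext' fun m n => ?_)
    simp [BalancedTensor.map]
  map_comp f h := by
    ext : 1
    refine Submodule.linearMap_qext _ (TensorProduct.ext' fun m n => ?_)
    simp [BalancedTensor.map]

instance (k : Type u) [Field k] (A : Type u) [Ring A] [Algebra k A]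
    (M : Type u) [AddCommGroup M] [Module k M] [Module Aᵐᵒᵖ M] [IsScalarTower k Aᵐᵒᵖ M] :
    (balancedTensorFunctor k A M).Additive where
  map_add {N N' f h} := by
    ext : 1
    rw [ModuleCat.hom_add]
    refine Submodule.linearMap_qext _ (TensorProduct.ext' fun m n => ?_)
    change Submodule.Quotient.mk (m ⊗ₜ[k] (f.hom n + h.hom n)) =
      (Submodule.Quotient.mk (m ⊗ₜ[k] f.hom n) + Submodule.Quotient.mk (m ⊗ₜ[k] h.hom n) :
        BalancedTensor k A M N')
    rw [TensorProduct.tmul_add, Submodule.Quotient.mk_add]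

/-- `Tor_i^A(M, N)`: the value at `N` of the `i`-th left derived functor of `M ⊗_A -`. -/
def algebraTor (k : Type u) [Field k] (A : Type u) [Ring A] [Algebra k A]
    (M : Type u) [AddCommGroup M] [Module k M] [Module Aᵐᵒᵖ M] [IsScalarTower k Aᵐᵒᵖ M]
    (i : ℕ) (N : ModuleCat.{u} A) : ModuleCat.{u} k :=
  ((balancedTensorFunctor k A M).leftDerived i).obj N

/-! ### Homology with trivial coefficients -/

/-- The ground field `k`, as a (left and right) module over an augmented algebra `A`,
via the augmentation. -/
def TrivialModule {k : Type u} [Field k] {A : Type v} [Ring A] [Algebra k A]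
    (_aug : A →ₐ[k] k) : Type u := k

namespace TrivialModule

variable {k : Type u} [Field k] {A : Type v} [Ring A] [Algebra k A] (aug : A →ₐ[k] k)

instance : AddCommGroup (TrivialModule aug) := inferInstanceAs (AddCommGroup k)

instance : Module k (TrivialModule aug) := inferInstanceAs (Module k k)

/-- `a • x = aug(a) x`. -/
instance : Module A (TrivialModule aug) := Module.compHom k aug.toRingHom

/-- `x • a = x aug(a)`. -/
instance : Module Aᵐᵒᵖ (TrivialModule aug) :=
  Module.compHom k (aug.toRingHom.fromOpposite fun _ _ => mul_comm _ _)

instance : IsScalarTower k Aᵐᵒᵖ (TrivialModule aug) where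
  smul_assoc c a x := by
    change aug (c • a.unop) * (show k from x) = c * (aug a.unop * (show k from x))
    rw [map_smul, smul_eq_mul, mul_assoc]

end TrivialModule

/-- `H_i(g) = Tor_i^{U(g)}(k, k)`, the homology of the color Lie algebra `g` with trivial
coefficients, as a vector space over `k`. -/
def ColorLieAlgebra.homology {k : Type u} [Field k] {Γ : Type v} [AddCommGroup Γ]
    {ε : CommutationFactor k Γ} {g : Type u} [AddCommGroup g] [Module k g]
    (L : ColorLieAlgebra ε g) (i : ℕ) : ModuleCat.{u} k :=
  algebraTor k L.Enveloping (TrivialModule L.augmentation) i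
    (ModuleCat.of L.Enveloping (TrivialModule L.augmentation))

/-- The Poincaré series `∑ z^i dim H_i(g)`. -/
def ColorLieAlgebra.poincareSeries {k : Type u} [Field k] {Γ : Type v} [AddCommGroup Γ]
    {ε : CommutationFactor k Γ} {g : Type u} [AddCommGroup g] [Module k g]
    (L : ColorLieAlgebra ε g) : PowerSeries ℚ :=
  PowerSeries.mk fun i => (Module.finrank k (L.homology i) : ℚ)

end

/-!
For an abelian `g`, the algebra `U(g)` is generated by `x i` with `x i x j = E i j x j x i`, where
`E i j = ε(d i, d j)`; in particular `x i ^ 2 = 0` when `E i i = -1`. Sorting words with the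
corresponding signs lets `U(g)` act on formal combinations of ordered monomials, so the ordered
monomials, square free in the `x i` with `E i i = -1` (the odd ones), form a basis. The trivial
module is resolved by a color Koszul complex: an even variable contributes an exterior generator and
an odd variable a divided power algebra, so a generator of degree `m` is an exponent `c` with
`∑ c i = m` and `c i ≤ 1` for even `i`. For each `i`, a homotopy that divides by `x i` deforms the
complex onto the terms not involving `i`, and applying these one after another proves exactness.
All coefficients of the differential lie in the augmentation ideal, so it vanishes after tensoring
with `k`, and `dim H_m(g)` is the number of exponents of degree `m`; in the generating function an
even variable gives a factor `1 + z` and an odd one `1 / (1 - z)`.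
-/

noncomputable section

section Exponents

variable {ι : Type*} [DecidableEq ι]

lemma exists_eq_add_single {c : ι → ℕ} {i : ι} (hi : c i ≠ 0) :
    ∃ c' : ι → ℕ, c = c' + Pi.single i 1 :=
  ⟨c - Pi.single i 1, by
    ext j
    obtain rfl | hj := eq_or_ne j i
    · simp only [Pi.add_apply, Pi.sub_apply, Pi.single_eq_same]
      lia
    · simp [hj]⟩

section Fintype

variable [Fintype ι]

lemma prod_pow_add_single {M : Type*} [CommMonoid M] (F : ι → M) (a : ι → ℕ) (i : ι) :
    ∏ j, F j ^ (a + Pi.single i 1 : ι → ℕ) j = (∏ j, F j ^ a j) * F i := by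
  simp_rw [Pi.add_apply, pow_add, Finset.prod_mul_distrib]
  simp [Pi.single_apply]

lemma sum_add_single (c : ι → ℕ) (i : ι) :
    ∑ j, (c + Pi.single i 1 : ι → ℕ) j = ∑ j, c j + 1 := by
  simp [Finset.sum_add_distrib]

end Fintype

theorem exponent_induction [Finite ι] {p : (ι → ℕ) → Prop} (zero : p 0)
    (add_single : ∀ a i, p a → p (a + Pi.single i 1)) (a : ι → ℕ) : p a := by
  have := Fintype.ofFinite ι
  induction h : ∑ i, a i generalizing a with
  | zero =>
    obtain rfl : a = 0 := by simpa [funext_iff] using h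
    exact zero
  | succ m ih =>
    obtain ⟨i, -, hi⟩ := Finset.exists_ne_zero_of_sum_ne_zero (h.trans_ne m.succ_ne_zero)
    obtain ⟨a, rfl⟩ := exists_eq_add_single hi
    exact add_single a i (ih a (by simpa only [sum_add_single, Nat.succ_inj] using h))

end Exponents

section OrderedMonomial

variable {k A ι : Type*} [CommRing k] [Ring A] [Algebra k A]

lemma pow_mul_of_mul_eq_smul {x y : A} {e : k} (h : y * x = e • (x * y)) (m : ℕ) :
    y ^ m * x = e ^ m • (x * y ^ m) := by
  induction m with
  | zero => simp
  | succ m ih =>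
    rw [pow_succ y, mul_assoc, h, mul_smul_comm, ← mul_assoc, ih, smul_mul_assoc, smul_smul,
      mul_assoc, ← pow_succ, ← pow_succ']

lemma list_prod_pow_mul {E : ι → ι → k} {x : ι → A}
    (hx : ∀ i j, x i * x j = E i j • (x j * x i)) (a : ι → ℕ) (i : ι) (l : List ι) :
    (l.map fun j => x j ^ a j).prod * x i =
      (l.map fun j => E j i ^ a j).prod • (x i * (l.map fun j => x j ^ a j).prod) := by
  induction l with
  | nil => simp
  | cons j l ih =>
    simp only [List.map_cons, List.prod_cons]
    rw [mul_assoc, ih, mul_smul_comm, ← mul_assoc, pow_mul_of_mul_eq_smul (hx j i),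
      smul_mul_assoc, smul_smul, mul_assoc, mul_comm]

variable [LinearOrder ι]

lemma list_prod_pow_mul_of_mem {E : ι → ι → k} {x : ι → A}
    (hx : ∀ i j, x i * x j = E i j • (x j * x i)) (a : ι → ℕ) {i : ι} {l : List ι}
    (hl : l.SortedLT) (hi : i ∈ l) :
    (l.map fun j => x j ^ a j).prod * x i =
      (l.map fun j => (if i < j then E j i else 1) ^ a j).prod •
        (l.map fun j => x j ^ (a + Pi.single i 1 : ι → ℕ) j).prod := by
  induction l with
  | nil => simp at hi
  | cons j l ih =>
    obtain ⟨hj, hl⟩ := List.pairwise_cons.1 hl.pairwise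
    simp only [List.map_cons, List.prod_cons]
    obtain rfl | hij := eq_or_ne i j
    · have hE : (l.map fun j => (if i < j then E j i else 1) ^ a j) = l.map fun j => E j i ^ a j :=
        List.map_congr_left fun j h => by rw [if_pos (hj j h)]
      have hx' : (l.map fun j => x j ^ (a + Pi.single i 1 : ι → ℕ) j) = l.map fun j => x j ^ a j :=
        List.map_congr_left fun j h => by simp [(hj j h).ne']
      rw [hE, hx', mul_assoc, list_prod_pow_mul hx, mul_smul_comm, ← mul_assoc, ← pow_succ]
      simp
    · have hil : i ∈ l := (List.mem_cons.1 hi).resolve_left hij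
      rw [mul_assoc, ih hl.sortedLT hil, mul_smul_comm, if_neg (hj i hil).not_gt]
      simp [hij.symm]

variable [Fintype ι]

/-- The ordered monomial `∏ x i ^ a i`, with the factors in increasing order of `i`. -/
def orderedMonomial {A : Type*} [Monoid A] (x : ι → A) (a : ι → ℕ) : A :=
  ((Finset.univ.sort (· ≤ ·)).map fun i => x i ^ a i).prod

/-- The factor by which `orderedMonomial x a * x i` differs from the ordered monomial of exponent
`a + Pi.single i 1`, when `x i * x j = E i j • (x j * x i)`. -/
def normalOrderCoeff (E : ι → ι → k) (i : ι) (a : ι → ℕ) : k :=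
  ∏ j, (if i < j then E j i else 1) ^ a j

@[simp]
lemma orderedMonomial_zero (x : ι → A) : orderedMonomial x 0 = 1 := by
  simp [orderedMonomial]

lemma orderedMonomial_mul {E : ι → ι → k} {x : ι → A}
    (hx : ∀ i j, x i * x j = E i j • (x j * x i)) (a : ι → ℕ) (i : ι) :
    orderedMonomial x a * x i =
      normalOrderCoeff E i a • orderedMonomial x (a + Pi.single i 1) := by
  rw [orderedMonomial, list_prod_pow_mul_of_mem hx a (Finset.sortedLT_sort _) (by simp),
    ← List.prod_toFinset _ (Finset.sort_nodup _ _), Finset.sort_toFinset]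
  rfl

lemma orderedMonomial_eq_zero_of_pow_eq_zero {x : ι → A} {a : ι → ℕ} {i : ι} (hi : x i ^ a i = 0) :
    orderedMonomial x a = 0 :=
  List.prod_eq_zero (List.mem_map.2 ⟨i, by simp, hi⟩)

lemma normalOrderCoeff_add_single (E : ι → ι → k) (i j : ι) (a : ι → ℕ) :
    normalOrderCoeff E i (a + Pi.single j 1) =
      normalOrderCoeff E i a * if i < j then E j i else 1 :=
  prod_pow_add_single (fun j => if i < j then E j i else 1) a j

end OrderedMonomial

section CommutationMatrix

variable {k ι : Type*} [Field k] {E : ι → ι → k}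

lemma ne_zero_of_mul_swap (hE : ∀ i j, E i j * E j i = 1) (i j : ι) : E i j ≠ 0 :=
  left_ne_zero_of_mul_eq_one (hE i j)

lemma eq_one_of_mul_swap (hE : ∀ i j, E i j * E j i = 1) {i : ι} (hi : E i i ≠ -1) :
    E i i = 1 :=
  (mul_self_eq_one_iff.1 (hE i i)).resolve_right hi

variable [LinearOrder ι] [Fintype ι]

lemma normalOrderCoeff_ne_zero (hE : ∀ i j, E i j * E j i = 1) (i : ι) (a : ι → ℕ) :
    normalOrderCoeff E i a ≠ 0 :=
  Finset.prod_ne_zero_iff.2 fun j _ => pow_ne_zero _ <| by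
    split_ifs
    exacts [ne_zero_of_mul_swap hE j i, one_ne_zero]

lemma normalOrderCoeff_mul_comm (hE : ∀ i j, E i j * E j i = 1) {i j : ι} (hij : i ≠ j)
    (a : ι → ℕ) :
    normalOrderCoeff E i a * normalOrderCoeff E j (a + Pi.single i 1) =
      E i j * (normalOrderCoeff E j a * normalOrderCoeff E i (a + Pi.single j 1)) := by
  simp only [normalOrderCoeff_add_single]
  obtain h | h := hij.lt_or_gt
  · rw [if_neg h.not_gt, if_pos h]
    linear_combination -normalOrderCoeff E i a * normalOrderCoeff E j a * hE i j
  · rw [if_pos h, if_neg h.not_gt]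
    ring

end CommutationMatrix

section MonomialExponents

variable {k ι : Type*} [Ring k]

/-- The exponents of the nonzero ordered monomials in generators satisfying `IsSkewCommuting E`:
the odd generators, those with `E i i = -1`, occur at most once. -/
def monomialExponents (E : ι → ι → k) : Set (ι → ℕ) :=
  {a | ∀ i, E i i = -1 → a i ≤ 1}

variable {E : ι → ι → k}

lemma add_single_mem_monomialExponents [DecidableEq ι] {a : ι → ℕ} {i : ι} :
    a + Pi.single i 1 ∈ monomialExponents E ↔
      a ∈ monomialExponents E ∧ (E i i = -1 → a i = 0) := by
  constructor
  · refine fun h => ⟨fun j hj => (Nat.le_add_right _ _).trans (h j hj), fun hi => ?_⟩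
    simpa using h i hi
  · rintro ⟨ha, hi⟩ j hj
    obtain rfl | hij := eq_or_ne j i
    · simp [hi hj]
    · simpa [hij] using ha j hj

end MonomialExponents

variable {k A ι : Type*} [Field k] [Ring A] [Algebra k A]

/-- The elements `x i` satisfy the relations of the enveloping algebra of an abelian color Lie
algebra: they commute up to the factors `E i j`, and those with `E i i = -1` have square zero. -/
structure IsSkewCommuting (E : ι → ι → k) (x : ι → A) : Prop where
  mul_comm : ∀ i j, x i * x j = E i j • (x j * x i)
  mul_self : ∀ i, E i i = -1 → x i * x i = 0

variable {E : ι → ι → k} {x : ι → A}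

namespace IsSkewCommuting

lemma of_two_ne_zero (h2 : (2 : k) ≠ 0) (hx : ∀ i j, x i * x j = E i j • (x j * x i)) :
    IsSkewCommuting E x where
  mul_comm := hx
  mul_self i hi := by
    have h := hx i i
    rw [hi, neg_one_smul, eq_neg_iff_add_eq_zero, ← two_smul k] at h
    exact (smul_eq_zero.1 h).resolve_left h2

variable [LinearOrder ι] [Fintype ι]

lemma orderedMonomial_eq_zero (h : IsSkewCommuting E x) {a : ι → ℕ}
    (ha : a ∉ monomialExponents E) : orderedMonomial x a = 0 := by
  simp only [monomialExponents, Set.mem_ofPred_eq, not_forall, not_le] at ha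
  obtain ⟨i, hi, hai⟩ := ha
  exact orderedMonomial_eq_zero_of_pow_eq_zero (i := i)
    (pow_eq_zero_of_le hai (by rw [pow_two, h.mul_self i hi]))

theorem span_orderedMonomial (h : IsSkewCommuting E x) (hx : Algebra.adjoin k (Set.range x) = ⊤) :
    Submodule.span k (Set.range fun a : monomialExponents E => orderedMonomial x a) = ⊤ := by
  set V := Submodule.span k (Set.range fun a : monomialExponents E => orderedMonomial x a)
  have mem_V (a : ι → ℕ) : orderedMonomial x a ∈ V := by
    by_cases ha : a ∈ monomialExponents E
    · exact Submodule.subset_span ⟨⟨a, ha⟩, rfl⟩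
    · exact h.orderedMonomial_eq_zero ha ▸ V.zero_mem
  have mul_generator_mem (i : ι) {v : A} (hv : v ∈ V) : v * x i ∈ V := by
    suffices V ≤ V.comap (LinearMap.mulRight k (x i)) from this hv
    rw [Submodule.span_le]
    rintro _ ⟨a, rfl⟩
    simpa only [SetLike.mem_coe, Submodule.mem_comap, LinearMap.mulRight_apply,
      orderedMonomial_mul h.mul_comm] using V.smul_mem _ (mem_V _)
  have mul_mem (u : A) : ∀ v ∈ V, v * u ∈ V := by
    have hu : u ∈ Algebra.adjoin k (Set.range x) := hx ▸ Algebra.mem_top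
    induction hu using Algebra.adjoin_induction with
    | mem _ hu =>
      obtain ⟨i, rfl⟩ := hu
      exact fun v => mul_generator_mem i
    | algebraMap r =>
      intro v hv
      rw [← Algebra.commutes, ← Algebra.smul_def]
      exact V.smul_mem r hv
    | add u u' _ _ hu hu' => exact fun v hv => mul_add v u u' ▸ V.add_mem (hu v hv) (hu' v hv)
    | mul u u' _ _ hu hu' => exact fun v hv => mul_assoc v u u' ▸ hu' _ (hu v hv)
  refine eq_top_iff.2 fun u _ => ?_
  simpa using mul_mem u 1 (orderedMonomial_zero x ▸ mem_V 0)

end IsSkewCommuting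

section FormalMul

variable [LinearOrder ι] [Fintype ι]

open Classical in
/-- Right multiplication by the `i`-th generator on formal linear combinations of ordered
monomials. -/
def formalMul (E : ι → ι → k) (i : ι) : Module.End k ((ι → ℕ) →₀ k) :=
  Finsupp.linearCombination k fun a => Finsupp.single (a + Pi.single i 1)
    (if E i i = -1 ∧ a i ≠ 0 then 0 else normalOrderCoeff E i a)

open Classical in
lemma formalMul_single (i : ι) (a : ι → ℕ) (r : k) :
    formalMul E i (Finsupp.single a r) = Finsupp.single (a + Pi.single i 1)
      (r * if E i i = -1 ∧ a i ≠ 0 then 0 else normalOrderCoeff E i a) := by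
  rw [formalMul, Finsupp.linearCombination_single, Finsupp.smul_single, smul_eq_mul]

lemma formalMul_comm (hE : ∀ i j, E i j * E j i = 1) (i j : ι) :
    formalMul E j * formalMul E i = E i j • (formalMul E i * formalMul E j) := by
  refine Finsupp.lhom_ext fun a r => ?_
  simp only [Module.End.mul_apply, LinearMap.smul_apply, formalMul_single, Finsupp.smul_single,
    smul_eq_mul, add_right_comm a (Pi.single i 1)]
  congr 1
  obtain rfl | hij := eq_or_ne i j
  · by_cases hi : E i i = -1
    · simp [hi]
    · simp [eq_one_of_mul_swap hE hi]
  · have hi : (a + Pi.single j 1 : ι → ℕ) i = a i := by simp [hij]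
    have hj : (a + Pi.single i 1 : ι → ℕ) j = a j := by simp [hij.symm]
    rw [hi, hj]
    split_ifs
    any_goals simp only [mul_zero, zero_mul]
    linear_combination r * normalOrderCoeff_mul_comm hE hij a

variable {φ : A →ₐ[k] (Module.End k ((ι → ℕ) →₀ k))ᵐᵒᵖ}

lemma unop_orderedMonomial_single_zero (hE : ∀ i j, E i j * E j i = 1)
    (hx : ∀ i j, x i * x j = E i j • (x j * x i))
    (hφ : ∀ i, φ (x i) = MulOpposite.op (formalMul E i)) {a : ι → ℕ}
    (ha : a ∈ monomialExponents E) :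
    (φ (orderedMonomial x a)).unop (Finsupp.single 0 1) = Finsupp.single a 1 := by
  induction a using exponent_induction with
  | zero => simp
  | add_single a i ih =>
    obtain ⟨ha, hi⟩ := add_single_mem_monomialExponents.1 ha
    have hn := normalOrderCoeff_ne_zero hE i a
    have hmul : orderedMonomial x (a + Pi.single i 1) =
        (normalOrderCoeff E i a)⁻¹ • (orderedMonomial x a * x i) := by
      rw [orderedMonomial_mul hx, inv_smul_smul₀ hn]
    rw [hmul, map_smul, map_mul, hφ, MulOpposite.unop_smul, MulOpposite.unop_mul,
      MulOpposite.unop_op, LinearMap.smul_apply, Module.End.mul_apply, ih ha, formalMul_single,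
      if_neg fun h => h.2 (hi h.1), Finsupp.smul_single, smul_eq_mul, one_mul,
      inv_mul_cancel₀ hn]

theorem linearIndependent_orderedMonomial (hE : ∀ i j, E i j * E j i = 1)
    (hx : ∀ i j, x i * x j = E i j • (x j * x i))
    (hφ : ∀ i, φ (x i) = MulOpposite.op (formalMul E i)) :
    LinearIndependent k fun a : monomialExponents E => orderedMonomial x a := by
  let evalOne : A →ₗ[k] ((ι → ℕ) →₀ k) := LinearMap.applyₗ (Finsupp.single 0 1) ∘ₗ
    (MulOpposite.opLinearEquiv k).symm.toLinearMap ∘ₗ φ.toLinearMap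
  refine LinearIndependent.of_comp evalOne ?_
  convert (Finsupp.linearIndependent_single_one k (ι → ℕ)).comp _
    (Subtype.val_injective (p := (· ∈ monomialExponents E))) with a
  exact funext fun a => unop_orderedMonomial_single_zero hE hx hφ a.2

end FormalMul

variable [LinearOrder ι] [Fintype ι]

/-- The algebra `A` is the skew polynomial algebra on the generators `x i` with commutation factors
`E i j`: the relations `IsSkewCommuting E x` hold and the ordered monomials form a basis of `A`. -/
structure IsSkewPolynomial (E : ι → ι → k) (x : ι → A) : Prop extends IsSkewCommuting E x where
  mul_swap : ∀ i j, E i j * E j i = 1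
  linearIndependent :
    LinearIndependent k fun a : monomialExponents E => orderedMonomial x a
  span_eq_top :
    Submodule.span k (Set.range fun a : monomialExponents E => orderedMonomial x a) = ⊤

namespace IsSkewPolynomial

/-- The basis of ordered monomials. -/
def basis (h : IsSkewPolynomial E x) : Module.Basis (monomialExponents E) k A :=
  Module.Basis.mk h.linearIndependent h.span_eq_top.ge

@[simp]
lemma basis_apply (h : IsSkewPolynomial E x) (a : monomialExponents E) :
    h.basis a = orderedMonomial x a :=
  Module.Basis.mk_apply _ _ a

lemma ext_orderedMonomial (h : IsSkewPolynomial E x) {M : Type*} [AddCommGroup M] [Module k M]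
    {f f' : A →ₗ[k] M}
    (hf : ∀ a ∈ monomialExponents E, f (orderedMonomial x a) = f' (orderedMonomial x a)) :
    f = f' :=
  h.basis.ext fun a => by simpa only [basis_apply] using hf a a.2

end IsSkewPolynomial

lemma CommutationFactor.val_mul_swap {k : Type u} [Field k] {Γ : Type v} [AddCommGroup Γ]
    (ε : CommutationFactor k Γ) (α β : Γ) : ε.val α β * ε.val β α = 1 := by
  rw [val, val, ← Units.val_mul, ε.mul_swap, Units.val_one]

namespace ColorLieAlgebra

variable {k : Type u} [Field k] {Γ : Type v} [AddCommGroup Γ] {ε : CommutationFactor k Γ}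
  {g : Type w} [AddCommGroup g] [Module k g] {L : ColorLieAlgebra ε g}

variable (L) in
/-- The canonical map of `g` to its enveloping algebra. -/
def toEnveloping : g →ₗ[k] L.Enveloping :=
  (RingQuot.mkAlgHom k L.EnvelopingRel).toLinearMap ∘ₗ TensorAlgebra.ι k

lemma augmentation_toEnveloping (a : g) : L.augmentation (L.toEnveloping a) = 0 := by
  simp [toEnveloping, augmentation]

lemma toEnveloping_mul (hL : L.IsAbelian) {α β : Γ} {a c : g} (ha : a ∈ L.component α)
    (hc : c ∈ L.component β) :
    L.toEnveloping a * L.toEnveloping c =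
      ε.val α β • (L.toEnveloping c * L.toEnveloping a) := by
  have := RingQuot.mkAlgHom_rel k (EnvelopingRel.of (L := L) α β a c ha hc)
  rwa [hL, map_zero, map_zero, map_sub, map_mul, map_smul, map_mul, sub_eq_zero] at this

variable {ι : Type*} (b : Module.Basis ι k g) {deg : ι → Γ}
  (hb : ∀ i, b i ∈ L.component (deg i))

lemma adjoin_range_toEnveloping :
    Algebra.adjoin k (Set.range fun i => L.toEnveloping (b i)) = ⊤ := by
  have hspan : Submodule.span k (Set.range fun i => L.toEnveloping (b i)) =
      LinearMap.range L.toEnveloping := by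
    rw [Set.range_comp', ← Submodule.map_span, b.span_eq, Submodule.map_top]
  rw [← Algebra.adjoin_span k, hspan, toEnveloping, LinearMap.coe_range, LinearMap.coe_comp,
    Set.range_comp, AlgHom.coe_toLinearMap, ← AlgHom.map_adjoin, TensorAlgebra.adjoin_range_ι,
    Algebra.map_top, AlgHom.range_eq_top]
  exact RingQuot.mkAlgHom_surjective k L.EnvelopingRel

include hb

lemma component_le_span_basis (α : Γ) :
    L.component α ≤ Submodule.span k (b '' {i | deg i = α}) := by
  classical
  intro a ha
  let := L.isInternal.chooseDecomposition
  let p : g →ₗ[k] g := (L.component α).subtype ∘ₗ DirectSum.component k Γ _ α ∘ₗ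
    (DirectSum.decomposeLinearEquiv L.component).toLinearMap
  have hp (i : ι) : p (b i) = if deg i = α then b i else 0 := by
    split_ifs with h
    · exact DirectSum.decompose_of_mem_same L.component (h ▸ hb i)
    · exact DirectSum.decompose_of_mem_ne L.component (hb i) h
  have hpa : p a = a := DirectSum.decompose_of_mem_same L.component ha
  have hrange : ⊤ ≤ (Submodule.span k (b '' {i | deg i = α})).comap p := by
    rw [← b.span_eq, Submodule.span_le]
    rintro _ ⟨i, rfl⟩
    rw [SetLike.mem_coe, Submodule.mem_comap, hp]
    split_ifs with h
    · exact Submodule.subset_span ⟨i, h, rfl⟩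
    · exact Submodule.zero_mem _
  exact hpa ▸ hrange Submodule.mem_top

lemma map_mul_map_of_mem_component {R : Type*} [Ring R] [Algebra k R] {f : g →ₗ[k] R}
    (hf : ∀ i j, f (b i) * f (b j) = ε.val (deg i) (deg j) • (f (b j) * f (b i))) {α β : Γ}
    {a c : g} (ha : a ∈ L.component α) (hc : c ∈ L.component β) :
    f a * f c = ε.val α β • (f c * f a) := by
  replace ha := component_le_span_basis b hb α ha
  replace hc := component_le_span_basis b hb β hc
  induction ha, hc using Submodule.span_induction₂ with
  | mem_mem a c ha hc =>
    obtain ⟨⟨i, rfl, rfl⟩, j, rfl, rfl⟩ := And.intro ha hc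
    exact hf i j
  | zero_left | zero_right => simp
  | add_left a a' c _ _ _ h h' => simp only [map_add, add_mul, mul_add, h, h', smul_add]
  | add_right a c c' _ _ _ h h' => simp only [map_add, add_mul, mul_add, h, h', smul_add]
  | smul_left r a c _ _ h => simp only [map_smul, smul_mul_assoc, mul_smul_comm, h, smul_comm r]
  | smul_right r a c _ _ h => simp only [map_smul, smul_mul_assoc, mul_smul_comm, h, smul_comm r]

/-- The universal property of the enveloping algebra of an abelian color Lie algebra with a
homogeneous basis. -/
def envelopingLift (hL : L.IsAbelian) {R : Type*} [Ring R] [Algebra k R] (y : ι → R)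
    (hy : ∀ i j, y i * y j = ε.val (deg i) (deg j) • (y j * y i)) : L.Enveloping →ₐ[k] R :=
  RingQuot.liftAlgHom k ⟨TensorAlgebra.lift k (b.constr k y), by
    rintro _ _ ⟨α, β, a, c, ha, hc⟩
    rw [hL, map_zero, map_zero, map_sub, map_mul, map_smul, map_mul, TensorAlgebra.lift_ι_apply,
      TensorAlgebra.lift_ι_apply, sub_eq_zero]
    exact map_mul_map_of_mem_component b hb (by simpa only [b.constr_basis] using hy) ha hc⟩

@[simp]
lemma envelopingLift_toEnveloping (hL : L.IsAbelian) {R : Type*} [Ring R] [Algebra k R]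
    (y : ι → R) (hy : ∀ i j, y i * y j = ε.val (deg i) (deg j) • (y j * y i)) (i : ι) :
    envelopingLift b hb hL y hy (L.toEnveloping (b i)) = y i := by
  simp [envelopingLift, toEnveloping]

theorem isSkewPolynomial_toEnveloping (hk2 : (2 : k) ≠ 0) (hL : L.IsAbelian) [LinearOrder ι]
    [Fintype ι] :
    IsSkewPolynomial (fun i j => ε.val (deg i) (deg j)) fun i => L.toEnveloping (b i) := by
  have hcomm : IsSkewCommuting (fun i j => ε.val (deg i) (deg j))
      fun i => L.toEnveloping (b i) :=
    .of_two_ne_zero hk2 fun i j => toEnveloping_mul hL (hb i) (hb j)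
  have hE (i j : ι) := ε.val_mul_swap (deg i) (deg j)
  let formalOp (i : ι) : (Module.End k ((ι → ℕ) →₀ k))ᵐᵒᵖ :=
    MulOpposite.op (formalMul (fun i j => ε.val (deg i) (deg j)) i)
  have hformal (i j : ι) :
      formalOp i * formalOp j = ε.val (deg i) (deg j) • (formalOp j * formalOp i) :=
    congrArg MulOpposite.op (formalMul_comm hE i j)
  exact ⟨hcomm, hE, linearIndependent_orderedMonomial hE hcomm.mul_comm
    (envelopingLift_toEnveloping b hb hL formalOp hformal),
    hcomm.span_orderedMonomial (adjoin_range_toEnveloping b)⟩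

end ColorLieAlgebra

section KoszulCoeff

variable {k ι : Type*} [Field k] [LinearOrder ι] [Fintype ι]

open Classical in
/-- The coefficient of `x i` in the `i`-th component of the Koszul differential, which lowers the
exponent `c + Pi.single i 1` to `c`. It vanishes when `i` is even and already occurs in `c`. -/
def koszulCoeff (E : ι → ι → k) (i : ι) (c : ι → ℕ) : k :=
  if E i i ≠ -1 ∧ c i ≠ 0 then 0 else ∏ j, (if j < i then -E j i else 1) ^ c j

variable {E : ι → ι → k} {i j : ι} {c : ι → ℕ}

lemma koszulCoeff_eq_zero (hi : E i i ≠ -1) (hc : c i ≠ 0) : koszulCoeff E i c = 0 :=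
  if_pos ⟨hi, hc⟩

lemma koszulCoeff_ne_zero (hE : ∀ i j, E i j * E j i = 1) (h : E i i ≠ -1 → c i = 0) :
    koszulCoeff E i c ≠ 0 := by
  rw [koszulCoeff, if_neg (by tauto), Finset.prod_ne_zero_iff]
  refine fun j _ => pow_ne_zero _ ?_
  split_ifs
  exacts [neg_ne_zero.2 (ne_zero_of_mul_swap hE j i), one_ne_zero]

lemma koszulCoeff_add_single (hij : i ≠ j) :
    koszulCoeff E i (c + Pi.single j 1) = koszulCoeff E i c * if j < i then -E j i else 1 := by
  have hc : (c + Pi.single j 1 : ι → ℕ) i = c i := by simp [hij]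
  rw [koszulCoeff, koszulCoeff, hc, ite_mul, zero_mul,
    prod_pow_add_single fun j => if j < i then -E j i else 1]

lemma koszulCoeff_mul_comm (hE : ∀ i j, E i j * E j i = 1) (hij : i ≠ j) :
    koszulCoeff E i c * koszulCoeff E j (c + Pi.single i 1) =
      -(E i j * (koszulCoeff E j c * koszulCoeff E i (c + Pi.single j 1))) := by
  rw [koszulCoeff_add_single hij, koszulCoeff_add_single hij.symm]
  obtain h | h := hij.lt_or_gt
  · rw [if_pos h, if_neg h.not_gt]
    ring
  · rw [if_neg h.not_gt, if_pos h]
    linear_combination -koszulCoeff E i c * koszulCoeff E j c * hE i j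

lemma inv_koszulCoeff_mul_comm (hE : ∀ i j, E i j * E j i = 1) (hij : i ≠ j) :
    (koszulCoeff E i c)⁻¹ * koszulCoeff E j c * E i j =
      -(koszulCoeff E j (c + Pi.single i 1) * (koszulCoeff E i (c + Pi.single j 1))⁻¹) := by
  obtain h0 | h0 := eq_or_ne (koszulCoeff E i c) 0
  · simp [koszulCoeff_add_single hij, h0]
  have h1 : koszulCoeff E i (c + Pi.single j 1) ≠ 0 := by
    rw [koszulCoeff_add_single hij]
    refine mul_ne_zero h0 ?_
    split_ifs
    exacts [neg_ne_zero.2 (ne_zero_of_mul_swap hE j i), one_ne_zero]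
  field_simp
  linear_combination koszulCoeff_mul_comm (c := c) hE hij

end KoszulCoeff

lemma sum_sum_eq_zero_of_antisymm {ι M : Type*} [Fintype ι] [AddCommGroup M] {f : ι → ι → M}
    (hself : ∀ i, f i i = 0) (hswap : ∀ i j, i ≠ j → f i j = -f j i) : ∑ i, ∑ j, f i j = 0 := by
  rw [← Fintype.sum_prod_type']
  refine Finset.sum_involution (fun p _ => p.swap) (fun p _ => ?_) (fun p _ hp h => hp ?_)
    (fun p _ => Finset.mem_univ _) (fun p _ => p.swap_swap)
  · obtain h | h := eq_or_ne p.1 p.2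
    · simp [h, hself]
    · simp [hswap _ _ h]
  · rw [show p.1 = p.2 from congrArg Prod.snd h, hself]

section KoszulDifferential

variable {k A ι : Type*} [Field k] [Ring A] [Algebra k A] [LinearOrder ι] [Fintype ι]
  {E : ι → ι → k} {x : ι → A} {i j : ι}

variable (E x) in
/-- The `i`-th component of the Koszul differential, on the free module with one generator for
each exponent; `Finsupp.single c u` plays the role of `u` times a divided monomial of exponent `c`
in generators dual to the `x i`. -/
def koszulPartial (i : ι) : ((ι → ℕ) →₀ A) →ₗ[A] ((ι → ℕ) →₀ A) :=
  Finsupp.linearCombination A fun c => if c i = 0 then 0 else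
    Finsupp.single (c - Pi.single i 1) (koszulCoeff E i (c - Pi.single i 1) • x i)

lemma koszulPartial_single_of_eq_zero {c : ι → ℕ} (hc : c i = 0) (u : A) :
    koszulPartial E x i (Finsupp.single c u) = 0 := by
  rw [koszulPartial, Finsupp.linearCombination_single, if_pos hc, smul_zero]

lemma koszulPartial_single_add (c : ι → ℕ) (u : A) :
    koszulPartial E x i (Finsupp.single (c + Pi.single i 1) u) =
      Finsupp.single c (koszulCoeff E i c • (u * x i)) := by
  rw [koszulPartial, Finsupp.linearCombination_single, if_neg (by simp), add_tsub_cancel_right,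
    Finsupp.smul_single, smul_eq_mul, mul_smul_comm]

lemma koszulPartial_koszulPartial_eq_zero (hij : i ≠ j) {c : ι → ℕ} (hc : c i = 0) (u : A) :
    koszulPartial E x i (koszulPartial E x j (Finsupp.single c u)) = 0 := by
  by_cases hj : c j = 0
  · rw [koszulPartial_single_of_eq_zero hj, map_zero]
  · obtain ⟨c, rfl⟩ := exists_eq_add_single hj
    rw [koszulPartial_single_add, koszulPartial_single_of_eq_zero]
    simpa [hij] using hc

theorem koszulPartial_koszulPartial_of_ne (hE : ∀ i j, E i j * E j i = 1)
    (hx : ∀ i j, x i * x j = E i j • (x j * x i)) (hij : i ≠ j) (z : (ι → ℕ) →₀ A) :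
    koszulPartial E x i (koszulPartial E x j z) =
      -koszulPartial E x j (koszulPartial E x i z) := by
  induction z using Finsupp.induction_linear with
  | zero => simp
  | add y z hy hz => rw [map_add, map_add, hy, hz, map_add, map_add, neg_add]
  | single c u =>
    by_cases hi : c i = 0
    · rw [koszulPartial_koszulPartial_eq_zero hij hi, koszulPartial_single_of_eq_zero hi,
        map_zero, neg_zero]
    by_cases hj : c j = 0
    · rw [koszulPartial_koszulPartial_eq_zero hij.symm hj, koszulPartial_single_of_eq_zero hj,
        map_zero, neg_zero]
    obtain ⟨c, rfl⟩ := exists_eq_add_single hi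
    obtain ⟨c, rfl⟩ := exists_eq_add_single (c := c) (i := j) (by simpa [hij.symm] using hj)
    rw [koszulPartial_single_add, add_right_comm, koszulPartial_single_add,
      koszulPartial_single_add, koszulPartial_single_add, ← Finsupp.single_neg]
    simp only [smul_mul_assoc, mul_assoc, hx i j, mul_smul_comm, smul_smul, ← neg_smul]
    congr 2
    linear_combination koszulCoeff_mul_comm (c := c) hE hij

theorem koszulPartial_koszulPartial_self (hx : E i i = -1 → x i * x i = 0)
    (z : (ι → ℕ) →₀ A) : koszulPartial E x i (koszulPartial E x i z) = 0 := by
  induction z using Finsupp.induction_linear with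
  | zero => simp
  | add y z hy hz => rw [map_add, map_add, hy, hz, add_zero]
  | single c u =>
    by_cases hc : c i = 0
    · rw [koszulPartial_single_of_eq_zero hc, map_zero]
    obtain ⟨c, rfl⟩ := exists_eq_add_single hc
    rw [koszulPartial_single_add]
    by_cases hc : c i = 0
    · rw [koszulPartial_single_of_eq_zero hc]
    obtain ⟨c, rfl⟩ := exists_eq_add_single hc
    rw [koszulPartial_single_add]
    by_cases hi : E i i = -1
    · simp [mul_assoc, hx hi]
    · simp [koszulCoeff_eq_zero hi hc]

variable (E x) in
/-- The differential of the Koszul complex, on the direct sum of its terms `koszulModule A E m` and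
of further generators, whose exponents the complex leaves out. -/
def koszulD : ((ι → ℕ) →₀ A) →ₗ[A] ((ι → ℕ) →₀ A) :=
  ∑ i, koszulPartial E x i

theorem koszulD_koszulD (hE : ∀ i j, E i j * E j i = 1) (hx : IsSkewCommuting E x)
    (z : (ι → ℕ) →₀ A) : koszulD E x (koszulD E x z) = 0 := by
  simp only [koszulD, LinearMap.sum_apply, map_sum]
  exact sum_sum_eq_zero_of_antisymm (fun i => koszulPartial_koszulPartial_self (hx.mul_self i) z)
    fun i j hij => koszulPartial_koszulPartial_of_ne hE hx.mul_comm hij.symm z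

end KoszulDifferential

section KoszulHomotopy

variable {k A ι : Type*} [Field k] [Ring A] [Algebra k A] [LinearOrder ι] [Fintype ι]
  {E : ι → ι → k} {x : ι → A} {i j : ι} {a c : ι → ℕ}

namespace IsSkewPolynomial

/-- Division by `x i` from the right: it sends an ordered monomial divisible by `x i` to the
quotient and all other ordered monomials to `0`. -/
def divGenerator (h : IsSkewPolynomial E x) (i : ι) : A →ₗ[k] A :=
  h.basis.constr k fun a => if a.1 i = 0 then 0 else
    (normalOrderCoeff E i (a.1 - Pi.single i 1))⁻¹ • orderedMonomial x (a.1 - Pi.single i 1)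

variable (h : IsSkewPolynomial E x)

lemma divGenerator_orderedMonomial (ha : a ∈ monomialExponents E) :
    h.divGenerator i (orderedMonomial x a) = if a i = 0 then 0 else
      (normalOrderCoeff E i (a - Pi.single i 1))⁻¹ • orderedMonomial x (a - Pi.single i 1) := by
  rw [← h.basis_apply ⟨a, ha⟩, divGenerator, h.basis.constr_basis]

lemma divGenerator_eq_zero (ha : a i = 0) : h.divGenerator i (orderedMonomial x a) = 0 := by
  by_cases ha' : a ∈ monomialExponents E
  · rw [h.divGenerator_orderedMonomial ha', if_pos ha]
  · rw [h.orderedMonomial_eq_zero ha', map_zero]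

lemma divGenerator_mul_self (hi : E i i = -1 → a i = 0) :
    h.divGenerator i (orderedMonomial x a * x i) = orderedMonomial x a := by
  by_cases ha : a ∈ monomialExponents E
  · rw [orderedMonomial_mul h.mul_comm, map_smul,
      h.divGenerator_orderedMonomial (add_single_mem_monomialExponents.2 ⟨ha, hi⟩),
      if_neg (by simp), add_tsub_cancel_right,
      smul_inv_smul₀ (normalOrderCoeff_ne_zero h.mul_swap i a)]
  · rw [h.orderedMonomial_eq_zero ha, zero_mul, map_zero]

include h in
lemma orderedMonomial_add_single :
    orderedMonomial x (a + Pi.single i 1) =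
      (normalOrderCoeff E i a)⁻¹ • (orderedMonomial x a * x i) := by
  rw [orderedMonomial_mul h.mul_comm, inv_smul_smul₀ (normalOrderCoeff_ne_zero h.mul_swap i a)]

lemma divGenerator_mul_of_ne (hij : i ≠ j) (u : A) :
    h.divGenerator i (u * x j) = E i j • (h.divGenerator i u * x j) := by
  suffices h.divGenerator i ∘ₗ LinearMap.mulRight k (x j) =
      E i j • (LinearMap.mulRight k (x j) ∘ₗ h.divGenerator i) from LinearMap.congr_fun this u
  refine h.ext_orderedMonomial fun a ha => ?_
  simp only [LinearMap.comp_apply, LinearMap.smul_apply, LinearMap.mulRight_apply]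
  by_cases hi : a i = 0
  · rw [orderedMonomial_mul h.mul_comm, map_smul, h.divGenerator_eq_zero hi,
      h.divGenerator_eq_zero (by simp [hi, hij]), smul_zero, zero_mul, smul_zero]
  · obtain ⟨a, rfl⟩ := exists_eq_add_single hi
    have hai := (add_single_mem_monomialExponents.1 ha).2
    have hcancel : h.divGenerator i (orderedMonomial x a * x j * x i) =
        orderedMonomial x a * x j := by
      rw [orderedMonomial_mul h.mul_comm a j, smul_mul_assoc, map_smul,
        h.divGenerator_mul_self (by simpa [hij] using hai)]
    rw [h.orderedMonomial_add_single, smul_mul_assoc, mul_assoc, h.mul_comm i j,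
      mul_smul_comm, ← mul_assoc, map_smul, map_smul, hcancel, map_smul,
      h.divGenerator_mul_self hai, smul_mul_assoc, smul_comm]

lemma divGenerator_mul (ha : a ∈ monomialExponents E) (hi : a i ≠ 0) :
    h.divGenerator i (orderedMonomial x a) * x i = orderedMonomial x a := by
  obtain ⟨a, rfl⟩ := exists_eq_add_single hi
  rw [h.orderedMonomial_add_single, map_smul, smul_mul_assoc,
    h.divGenerator_mul_self (add_single_mem_monomialExponents.1 ha).2]

/-- The homotopy contracting the `i`-th component of the Koszul differential. It is only linear
over `k`. Where `koszulCoeff E i c` vanishes, its inverse is the junk value `0`, as it should. -/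
def koszulHomotopy (i : ι) : ((ι → ℕ) →₀ A) →ₗ[k] ((ι → ℕ) →₀ A) :=
  Finsupp.lsum k fun c => (koszulCoeff E i c)⁻¹ •
    (Finsupp.lsingle (c + Pi.single i 1) ∘ₗ h.divGenerator i)

lemma koszulHomotopy_single (u : A) :
    h.koszulHomotopy i (Finsupp.single c u) = Finsupp.single (c + Pi.single i 1)
      ((koszulCoeff E i c)⁻¹ • h.divGenerator i u) := by
  simp [koszulHomotopy]

theorem koszulHomotopy_koszulPartial_of_ne (hij : i ≠ j) (z : (ι → ℕ) →₀ A) :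
    h.koszulHomotopy i (koszulPartial E x j z) = -koszulPartial E x j (h.koszulHomotopy i z) := by
  induction z using Finsupp.induction_linear with
  | zero => simp
  | add y z hy hz => rw [map_add, map_add, hy, hz, map_add, map_add, neg_add]
  | single c u =>
    rw [koszulHomotopy_single]
    by_cases hj : c j = 0
    · rw [koszulPartial_single_of_eq_zero hj, koszulPartial_single_of_eq_zero
        (by simpa [hij.symm] using hj), map_zero, neg_zero]
    obtain ⟨c, rfl⟩ := exists_eq_add_single hj
    rw [koszulPartial_single_add, add_right_comm, koszulPartial_single_add,
      koszulHomotopy_single, map_smul, h.divGenerator_mul_of_ne hij, ← Finsupp.single_neg,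
      smul_mul_assoc, smul_smul, smul_smul, smul_smul, ← neg_smul]
    congr 2
    exact inv_koszulCoeff_mul_comm h.mul_swap hij

lemma koszulPartial_koszulHomotopy_single (hc : E i i ≠ -1 → c i = 0) (u : A) :
    koszulPartial E x i (h.koszulHomotopy i (Finsupp.single c u)) =
      Finsupp.single c (h.divGenerator i u * x i) := by
  rw [koszulHomotopy_single, koszulPartial_single_add, smul_mul_assoc,
    smul_inv_smul₀ (koszulCoeff_ne_zero h.mul_swap hc)]

lemma koszulHomotopy_koszulPartial_single (hc : E i i ≠ -1 → c i = 0) (u : A) :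
    h.koszulHomotopy i (koszulPartial E x i (Finsupp.single (c + Pi.single i 1) u)) =
      Finsupp.single (c + Pi.single i 1) (h.divGenerator i (u * x i)) := by
  rw [koszulPartial_single_add, koszulHomotopy_single, map_smul,
    inv_smul_smul₀ (koszulCoeff_ne_zero h.mul_swap hc)]

end IsSkewPolynomial

end KoszulHomotopy

section KoszulExponents

variable {k A ι : Type*} [Ring k] [Ring A] [Fintype ι]

/-- The exponents of the generators of degree `m` of the Koszul complex: the even generators
occur at most once. -/
def koszulExponents (E : ι → ι → k) (m : ℕ) : Set (ι → ℕ) :=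
  {c | (∀ i, E i i ≠ -1 → c i ≤ 1) ∧ ∑ i, c i = m}

variable (A) in
/-- The term of degree `m` of the Koszul complex, inside the free module on all exponents. -/
def koszulModule (E : ι → ι → k) (m : ℕ) : Submodule A ((ι → ℕ) →₀ A) :=
  Finsupp.supported A A (koszulExponents E m)

variable {E : ι → ι → k} {m : ℕ} {c : ι → ℕ} {i : ι}

lemma koszulExponents_zero : koszulExponents E 0 = {0} := by
  ext c
  constructor
  · exact fun hc => funext fun i => Finset.sum_eq_zero_iff.1 hc.2 i (Finset.mem_univ i)
  · rintro rfl
    exact ⟨fun _ _ => zero_le_one, Finset.sum_eq_zero fun _ _ => rfl⟩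

lemma single_mem_koszulModule (hc : c ∈ koszulExponents E m) (u : A) :
    Finsupp.single c u ∈ koszulModule A E m :=
  Finsupp.single_mem_supported A u hc

lemma add_single_mem_koszulExponents [DecidableEq ι] :
    c + Pi.single i 1 ∈ koszulExponents E (m + 1) ↔
      c ∈ koszulExponents E m ∧ (E i i ≠ -1 → c i = 0) := by
  simp only [koszulExponents, Set.mem_ofPred_eq, sum_add_single, Nat.add_right_cancel_iff]
  constructor
  · refine fun ⟨hc, hm⟩ => ⟨⟨fun j hj => (Nat.le_add_right _ _).trans (hc j hj), hm⟩, fun hi => ?_⟩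
    simpa using hc i hi
  · rintro ⟨⟨hc, hm⟩, hi⟩
    refine ⟨fun j hj => ?_, hm⟩
    obtain rfl | hij := eq_or_ne j i
    · simp [hi hj]
    · simpa [hij] using hc j hj

end KoszulExponents

section KoszulModule

variable {k A ι : Type*} [Field k] [Ring A] [Algebra k A] [Fintype ι] {E : ι → ι → k} {m : ℕ}
  {c : ι → ℕ}

lemma map_mem_of_mem_koszulModule {M : Type*} [AddCommGroup M] [Module k M]
    {f : ((ι → ℕ) →₀ A) →ₗ[k] M} {p : Submodule k M}
    (hf : ∀ c ∈ koszulExponents E m, ∀ u, f (Finsupp.single c u) ∈ p)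
    {z : (ι → ℕ) →₀ A} (hz : z ∈ koszulModule A E m) : f z ∈ p := by
  rw [← z.sum_single, map_finsuppSum]
  exact p.sum_mem fun c hc => hf c (hz hc) _

variable [LinearOrder ι] {x : ι → A} {z : (ι → ℕ) →₀ A}

lemma koszulD_mem_koszulModule (hz : z ∈ koszulModule A E (m + 1)) :
    koszulD E x z ∈ koszulModule A E m := by
  refine map_mem_of_mem_koszulModule (f := (koszulD E x).restrictScalars k)
    (p := (koszulModule A E m).restrictScalars k) (fun c hc u => ?_) hz
  rw [LinearMap.restrictScalars_apply, koszulD, LinearMap.sum_apply]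
  refine Submodule.sum_mem _ fun i _ => ?_
  by_cases hi : c i = 0
  · rw [koszulPartial_single_of_eq_zero hi]
    exact Submodule.zero_mem _
  · obtain ⟨c, rfl⟩ := exists_eq_add_single hi
    rw [koszulPartial_single_add]
    exact single_mem_koszulModule (add_single_mem_koszulExponents.1 hc).1 _

lemma koszulD_apply_mem {I : Ideal A} (hI : ∀ i, x i ∈ I) (z : (ι → ℕ) →₀ A) (c : ι → ℕ) :
    koszulD E x z c ∈ I := by
  induction z using Finsupp.induction_linear with
  | zero => simp
  | add y z hy hz =>
    rw [map_add, Finsupp.add_apply]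
    exact I.add_mem hy hz
  | single c' u =>
    rw [koszulD, LinearMap.sum_apply, Finsupp.finsetSum_apply]
    refine I.sum_mem fun i _ => ?_
    by_cases hi : c' i = 0
    · simp [koszulPartial_single_of_eq_zero hi]
    · obtain ⟨c', rfl⟩ := exists_eq_add_single hi
      rw [koszulPartial_single_add, Finsupp.single_apply]
      split_ifs
      · exact I.smul_of_tower_mem _ (I.mul_mem_left _ (hI i))
      · exact I.zero_mem

lemma koszulD_eq_zero_of_mem (hz : z ∈ koszulModule A E 0) : koszulD E x z = 0 := by
  rw [koszulModule, koszulExponents_zero, Finsupp.mem_supported, Finset.coe_subset_singleton,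
    Finsupp.support_subset_singleton] at hz
  rw [hz, koszulD, LinearMap.sum_apply]
  exact Finset.sum_eq_zero fun i _ => koszulPartial_single_of_eq_zero (c := 0) rfl _

variable (x) in
/-- The part of `koszulModule A E m` spanned by the ordered monomials times generators which do
not involve the indices in `S`: what is left after contracting those indices. -/
def koszulResidual (E : ι → ι → k) (m : ℕ) (S : Set ι) : Submodule k ((ι → ℕ) →₀ A) :=
  Submodule.span k {z | ∃ c ∈ koszulExponents E m, ∃ a ∈ monomialExponents E,
    (∀ i ∈ S, a i = 0 ∧ c i = 0) ∧ Finsupp.single c (orderedMonomial x a) = z}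

lemma koszulResidual_succ_univ : koszulResidual x E (m + 1) Set.univ = ⊥ := by
  rw [koszulResidual, Submodule.span_eq_bot]
  rintro _ ⟨c, hc, a, -, hS, rfl⟩
  obtain rfl : c = 0 := funext fun i => (hS i trivial).2
  simpa using hc.2

lemma koszulResidual_zero_univ_le :
    koszulResidual x E 0 Set.univ ≤ Submodule.span k {Finsupp.single 0 1} := by
  refine Submodule.span_mono ?_
  rintro _ ⟨c, hc, a, -, hS, rfl⟩
  obtain rfl : a = 0 := funext fun i => (hS i trivial).1
  obtain rfl : c = 0 := funext fun i => (hS i trivial).2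
  simp

end KoszulModule

namespace IsSkewPolynomial

variable {k A ι : Type*} [Field k] [Ring A] [Algebra k A] [LinearOrder ι] [Fintype ι]
  {E : ι → ι → k} {x : ι → A} {i : ι} {a c : ι → ℕ} {m : ℕ} {z : (ι → ℕ) →₀ A} {S : Set ι}
  (h : IsSkewPolynomial E x)

lemma koszulHomotopy_mem_koszulModule (hz : z ∈ koszulModule A E m) :
    h.koszulHomotopy i z ∈ koszulModule A E (m + 1) := by
  refine map_mem_of_mem_koszulModule (p := (koszulModule A E (m + 1)).restrictScalars k)
    (fun c hc u => ?_) hz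
  rw [koszulHomotopy_single]
  by_cases hi : E i i ≠ -1 ∧ c i ≠ 0
  · rw [koszulCoeff_eq_zero hi.1 hi.2, inv_zero, zero_smul, Finsupp.single_zero]
    exact Submodule.zero_mem _
  · exact single_mem_koszulModule
      (add_single_mem_koszulExponents.2 ⟨hc, fun h1 => of_not_not fun h2 => hi ⟨h1, h2⟩⟩) _

include h in
lemma mem_koszulResidual_empty (hz : z ∈ koszulModule A E m) : z ∈ koszulResidual x E m ∅ := by
  refine map_mem_of_mem_koszulModule (f := LinearMap.id) (fun c hc u => ?_) hz
  suffices ⊤ ≤ (koszulResidual x E m ∅).comap (Finsupp.lsingle c) from this (x := u) trivial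
  rw [← h.span_eq_top, Submodule.span_le]
  rintro _ ⟨a, rfl⟩
  exact Submodule.subset_span ⟨c, hc, a, a.2, fun i hi => hi.elim, rfl⟩

lemma koszulD_koszulHomotopy_add (z : (ι → ℕ) →₀ A) :
    koszulD E x (h.koszulHomotopy i z) + h.koszulHomotopy i (koszulD E x z) =
      koszulPartial E x i (h.koszulHomotopy i z) + h.koszulHomotopy i (koszulPartial E x i z) := by
  simp only [koszulD, LinearMap.sum_apply, map_sum]
  rw [← Finset.sum_add_distrib]
  refine Fintype.sum_eq_single i fun j hj => ?_
  rw [h.koszulHomotopy_koszulPartial_of_ne hj.symm, add_neg_cancel]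

lemma koszulPartial_koszulHomotopy_add_of_eq_zero (ha : a i = 0) (hc : c i = 0) :
    koszulPartial E x i (h.koszulHomotopy i (Finsupp.single c (orderedMonomial x a))) +
      h.koszulHomotopy i (koszulPartial E x i (Finsupp.single c (orderedMonomial x a))) = 0 := by
  rw [koszulHomotopy_single, h.divGenerator_eq_zero ha, smul_zero, Finsupp.single_zero, map_zero,
    koszulPartial_single_of_eq_zero hc, map_zero, add_zero]

lemma koszulPartial_koszulHomotopy_add_of_ne_zero
    (ha : a ∈ monomialExponents E) (hc : E i i ≠ -1 → c i ≤ 1) (hac : a i ≠ 0 ∨ c i ≠ 0) :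
    koszulPartial E x i (h.koszulHomotopy i (Finsupp.single c (orderedMonomial x a))) +
      h.koszulHomotopy i (koszulPartial E x i (Finsupp.single c (orderedMonomial x a))) =
        Finsupp.single c (orderedMonomial x a) := by
  by_cases hci : c i = 0
  · rw [h.koszulPartial_koszulHomotopy_single fun _ => hci,
      h.divGenerator_mul ha (hac.resolve_right (not_not.2 hci)),
      koszulPartial_single_of_eq_zero hci, map_zero, add_zero]
  obtain ⟨c, rfl⟩ := exists_eq_add_single hci
  rw [h.koszulHomotopy_koszulPartial_single fun hi => by simpa using hc hi]
  by_cases hi : E i i = -1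
  · rw [h.koszulPartial_koszulHomotopy_single fun hi' => absurd hi hi', ← Finsupp.single_add]
    congr 1
    by_cases hai : a i = 0
    · rw [h.divGenerator_eq_zero hai, zero_mul, zero_add, h.divGenerator_mul_self fun _ => hai]
    · have hzero : orderedMonomial x a * x i = 0 := by
        rw [orderedMonomial_mul h.mul_comm, h.orderedMonomial_eq_zero
          fun h' => hai ((add_single_mem_monomialExponents.1 h').2 hi), smul_zero]
      rw [h.divGenerator_mul ha hai, hzero, map_zero, add_zero]
  · rw [koszulHomotopy_single, koszulCoeff_eq_zero hi hci, inv_zero, zero_smul,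
      Finsupp.single_zero, map_zero, zero_add, h.divGenerator_mul_self fun hi' => absurd hi' hi]

lemma sub_mem_koszulResidual_insert (hz : z ∈ koszulResidual x E m S) (i : ι) :
    z - (koszulD E x (h.koszulHomotopy i z) + h.koszulHomotopy i (koszulD E x z)) ∈
      koszulResidual x E m (insert i S) := by
  rw [h.koszulD_koszulHomotopy_add]
  induction hz using Submodule.span_induction with
  | zero => simp
  | add y z _ _ hy hz =>
    convert Submodule.add_mem _ hy hz using 1
    simp only [map_add]
    abel
  | smul r z _ hz =>
    convert Submodule.smul_mem _ r hz using 1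
    simp only [map_smul, LinearMap.map_smul_of_tower, smul_sub, smul_add]
  | mem _ hz =>
    obtain ⟨c, hc, a, ha, hS, rfl⟩ := hz
    by_cases hac : a i = 0 ∧ c i = 0
    · rw [h.koszulPartial_koszulHomotopy_add_of_eq_zero hac.1 hac.2, sub_zero]
      refine Submodule.subset_span ⟨c, hc, a, ha, ?_, rfl⟩
      rintro j (rfl | hj)
      exacts [hac, hS j hj]
    · rw [h.koszulPartial_koszulHomotopy_add_of_ne_zero ha (hc.1 i) (by tauto), sub_self]
      exact Submodule.zero_mem _

include h in
lemma exists_sub_koszulD_mem_koszulResidual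
    (hz : z ∈ koszulModule A E m) (hDz : koszulD E x z = 0) (S : Finset ι) :
    ∃ y ∈ koszulModule A E (m + 1), z - koszulD E x y ∈ koszulResidual x E m S := by
  induction S using Finset.induction_on with
  | empty =>
    exact ⟨0, Submodule.zero_mem _, by simpa using h.mem_koszulResidual_empty hz⟩
  | insert i S _ ih =>
    obtain ⟨y, hy, hzy⟩ := ih
    set z' := z - koszulD E x y
    have hz' : z' ∈ koszulModule A E m := Submodule.sub_mem _ hz (koszulD_mem_koszulModule hy)
    have hDz' : koszulD E x z' = 0 := by
      rw [map_sub, hDz, koszulD_koszulD h.mul_swap h.toIsSkewCommuting, sub_zero]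
    refine ⟨y + h.koszulHomotopy i z',
      Submodule.add_mem _ hy (h.koszulHomotopy_mem_koszulModule hz'), ?_⟩
    have hmem := h.sub_mem_koszulResidual_insert hzy i
    rw [hDz', map_zero, add_zero] at hmem
    rwa [map_add, ← sub_sub, Finset.coe_insert]

include h in
theorem exists_koszulD_eq (hz : z ∈ koszulModule A E (m + 1)) (hDz : koszulD E x z = 0) :
    ∃ y ∈ koszulModule A E (m + 2), koszulD E x y = z := by
  obtain ⟨y, hy, hzy⟩ := h.exists_sub_koszulD_mem_koszulResidual hz hDz Finset.univ
  rw [Finset.coe_univ, koszulResidual_succ_univ, Submodule.mem_bot, sub_eq_zero] at hzy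
  exact ⟨y, hy, hzy.symm⟩

include h in
theorem exists_koszulD_eq_of_apply_zero_mem {I : Ideal A}
    (hI : I ≠ ⊤) (hxI : ∀ i, x i ∈ I) (hz : z ∈ koszulModule A E 0) (hzI : z 0 ∈ I) :
    ∃ y ∈ koszulModule A E 1, koszulD E x y = z := by
  obtain ⟨y, hy, hzy⟩ := h.exists_sub_koszulD_mem_koszulResidual hz
    (koszulD_eq_zero_of_mem hz) Finset.univ
  rw [Finset.coe_univ] at hzy
  obtain ⟨r, hr⟩ := Submodule.mem_span_singleton.1 (koszulResidual_zero_univ_le hzy)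
  have hrI : r • (1 : A) ∈ I := by
    have := I.sub_mem hzI (koszulD_apply_mem (E := E) hxI y 0)
    rwa [← Finsupp.sub_apply, ← hr, Finsupp.smul_apply, Finsupp.single_eq_same] at this
  have hr0 : r = 0 := by
    by_contra hr0
    refine hI ((Ideal.eq_top_iff_one I).2 ?_)
    simpa [hr0] using I.smul_of_tower_mem r⁻¹ hrI
  rw [hr0, zero_smul, eq_comm, sub_eq_zero] at hr
  exact ⟨y, hy, hr.symm⟩

end IsSkewPolynomial

namespace BalancedTensor

variable {k : Type u} [Field k] {A : Type v} [Ring A] [Algebra k A]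
  {M : Type w} [AddCommGroup M] [Module k M] [Module Aᵐᵒᵖ M]
  {N N' C : Type*} [AddCommGroup N] [Module k N] [Module A N]
  [AddCommGroup N'] [Module k N'] [Module A N'] [IsScalarTower k A N']

lemma mk_smul_tmul (a : A) (y : M) (z : N) :
    (Submodule.Quotient.mk ((MulOpposite.op a • y) ⊗ₜ[k] z) : BalancedTensor k A M N) =
      Submodule.Quotient.mk (y ⊗ₜ[k] (a • z)) :=
  (Submodule.Quotient.eq _).2 (Submodule.subset_span ⟨y, a, z, rfl⟩)

variable [IsScalarTower k Aᵐᵒᵖ M] [IsScalarTower k A N]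

variable (k M) in
/-- The coordinates of the elements of `M ⊗_A N` with respect to an `A`-basis of `N`. -/
def coords (b : Module.Basis C A N) : BalancedTensor k A M N →ₗ[k] (C →₀ M) :=
  Submodule.liftQ _ (TensorProduct.lift <| LinearMap.mk₂ k
    (fun y z => (b.repr z).mapRange (fun a => MulOpposite.op a • y) (zero_smul _ y))
    (fun y y' z => Finsupp.ext fun c => smul_add _ y y')
    (fun r y z => Finsupp.ext fun c => smul_comm _ r y)
    (fun y z z' => by ext; simp [add_smul])
    (fun r y z => by
      have hrepr : b.repr (r • z) = r • b.repr z := b.repr.toLinearMap.map_smul_of_tower r z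
      ext c
      rw [Finsupp.mapRange_apply, hrepr, Finsupp.smul_apply, MulOpposite.op_smul, smul_assoc]
      rfl)) <| by
    rw [balancedRelations, Submodule.span_le]
    rintro _ ⟨y, a, z, rfl⟩
    ext c
    simp [mul_smul]

lemma coords_mk_tmul_apply (b : Module.Basis C A N) (y : M) (z : N) (c : C) :
    coords k M b (Submodule.Quotient.mk (y ⊗ₜ z)) c = MulOpposite.op (b.repr z c) • y :=
  rfl

lemma coords_mk_tmul_basis (b : Module.Basis C A N) (y : M) (c : C) :
    coords k M b (Submodule.Quotient.mk (y ⊗ₜ b c)) = Finsupp.single c y := by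
  ext c'
  obtain rfl | hc := eq_or_ne c c'
  · simp [coords_mk_tmul_apply]
  · simp [coords_mk_tmul_apply, hc.symm]

variable (k M) in
/-- The tensor product `M ⊗_A N` with a free module `N` is a direct sum of copies of `M`. -/
def equivFinsupp (b : Module.Basis C A N) : BalancedTensor k A M N ≃ₗ[k] (C →₀ M) := by
  let assemble : (C →₀ M) →ₗ[k] BalancedTensor k A M N :=
    Finsupp.lsum k fun c => Submodule.mkQ _ ∘ₗ (TensorProduct.mk k M N).flip (b c)
  have assemble_single (c : C) (y : M) :
      assemble (Finsupp.single c y) = Submodule.Quotient.mk (y ⊗ₜ b c) :=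
    Finsupp.lsum_single k _ _ _
  refine LinearEquiv.ofLinearMap (coords k M b) assemble
    (Finsupp.lhom_ext fun c y => ?_)
    (Submodule.linearMap_qext _ (TensorProduct.ext' fun y z => ?_))
  · rw [LinearMap.comp_apply, assemble_single, coords_mk_tmul_basis, LinearMap.id_apply]
  · change assemble (coords k M b (Submodule.Quotient.mk (y ⊗ₜ z))) = Submodule.Quotient.mk (y ⊗ₜ z)
    obtain ⟨f, rfl⟩ := b.repr.symm.surjective z
    induction f using Finsupp.induction_linear with
    | zero => simp
    | add f f' hf hf' =>
      rw [map_add, TensorProduct.tmul_add, Submodule.Quotient.mk_add, map_add, map_add, hf, hf']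
    | single c a =>
      rw [b.repr_symm_single, ← mk_smul_tmul, coords_mk_tmul_basis, assemble_single]

lemma map_eq_zero_of_forall_repr_smul_eq_zero (b : Module.Basis C A N') {f : N →ₗ[A] N'}
    (hf : ∀ z c (y : M), MulOpposite.op (b.repr (f z) c) • y = 0) : map k A M f = 0 := by
  refine Submodule.linearMap_qext _ (TensorProduct.ext' fun y z => ?_)
  refine (equivFinsupp k M b).injective (Finsupp.ext fun c => ?_)
  exact (hf z c y).trans (by simp)

end BalancedTensor

section Tor

variable {A : Type u} [Ring A] {K : ℕ → Type u} [∀ m, AddCommGroup (K m)] [∀ m, Module A (K m)]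
  {Z : Type u} [AddCommGroup Z] [Module A Z]
  {d : ∀ m, K (m + 1) →ₗ[A] K m} {π : K 0 →ₗ[A] Z}

/-- The chain complex formed by consecutive exact linear maps. -/
def complexOfExact (hd : ∀ m, Function.Exact (d (m + 1)) (d m)) :
    ChainComplex (ModuleCat.{u} A) ℕ :=
  ChainComplex.of (fun m => ModuleCat.of A (K m)) (fun m => ModuleCat.ofHom (d m)) fun m =>
    ModuleCat.hom_ext (hd m).linearMap_comp_eq_zero

lemma complexOfExact_d (hd : ∀ m, Function.Exact (d (m + 1)) (d m)) (m : ℕ) :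
    (complexOfExact hd).d (m + 1) m = ModuleCat.ofHom (d m) :=
  ChainComplex.of_d (fun m => ModuleCat.of A (K m)) (fun m => ModuleCat.ofHom (d m)) m

/-- The augmentation of `complexOfExact`. -/
def augmentationOfExact (hd : ∀ m, Function.Exact (d (m + 1)) (d m))
    (h0 : Function.Exact (d 0) π) :
    complexOfExact hd ⟶ (ChainComplex.single₀ (ModuleCat A)).obj (ModuleCat.of A Z) :=
  (ChainComplex.toSingle₀Equiv _ _).symm ⟨ModuleCat.ofHom π, by
    rw [complexOfExact_d]
    exact ModuleCat.hom_ext h0.linearMap_comp_eq_zero⟩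

lemma quasiIso_augmentationOfExact (hd : ∀ m, Function.Exact (d (m + 1)) (d m))
    (h0 : Function.Exact (d 0) π) (hπ : Function.Surjective π) :
    QuasiIso (augmentationOfExact hd h0) := by
  refine ⟨fun m => ?_⟩
  cases m with
  | zero =>
    rw [ChainComplex.quasiIsoAt₀_iff, ShortComplex.quasiIso_iff_of_zeros' _ rfl rfl rfl]
    have hw : ModuleCat.ofHom (d 0) ≫ ModuleCat.ofHom π = 0 :=
      ModuleCat.hom_ext h0.linearMap_comp_eq_zero
    refine (ShortComplex.exact_and_epi_g_iff_of_iso (S₁ := ShortComplex.mk _ _ hw) ?_).1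
      ⟨(ShortComplex.moduleCat_exact_iff _).2 fun z => (h0 z).1,
        (ModuleCat.epi_iff_surjective _).2 hπ⟩
    refine ShortComplex.isoMk (Iso.refl _) (Iso.refl _) (Iso.refl _) ?_ ?_
    · refine (Category.id_comp _).trans (Eq.trans ?_ (Category.comp_id _).symm)
      exact complexOfExact_d hd 0
    · refine (Category.id_comp _).trans (Eq.trans ?_ (Category.comp_id _).symm)
      exact ChainComplex.toSingle₀Equiv_symm_apply_f_zero _ _
  | succ m =>
    rw [quasiIsoAt_iff_exactAt' _ _ (ChainComplex.exactAt_succ_single_obj _ _),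
      HomologicalComplex.exactAt_iff' _ (m + 2) (m + 1) m (by simp) (by simp),
      ShortComplex.moduleCat_exact_iff]
    intro z hz
    change (complexOfExact hd).d (m + 1) m z = 0 at hz
    change ∃ y, (complexOfExact hd).d (m + 2) (m + 1) y = z
    rw [complexOfExact_d] at hz ⊢
    exact (hd m z).1 hz

/-- A free resolution, as an object of the category of modules. -/
def resolutionOfExact [∀ m, Module.Free A (K m)] (hd : ∀ m, Function.Exact (d (m + 1)) (d m))
    (h0 : Function.Exact (d 0) π) (hπ : Function.Surjective π) :
    ProjectiveResolution (ModuleCat.of A Z) where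
  complex := complexOfExact hd
  projective m := ModuleCat.projective_of_free (Module.Free.chooseBasis A (K m))
  π := augmentationOfExact hd h0
  quasiIso := quasiIso_augmentationOfExact hd h0 hπ

/-- `Tor` is read off a resolution by free modules whose differential vanishes after tensoring
with `M`. -/
def algebraTorEquivFinsupp {k : Type u} [Field k] [Algebra k A] {M : Type u} [AddCommGroup M]
    [Module k M] [Module Aᵐᵒᵖ M] [IsScalarTower k Aᵐᵒᵖ M] {N : ModuleCat.{u} A}
    (P : ProjectiveResolution N) {C : ℕ → Type*}
    (b : ∀ m, Module.Basis (C m) A (P.complex.X m))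
    (hP : ∀ m z c (y : M), MulOpposite.op ((b m).repr (P.complex.d (m + 1) m z) c) • y = 0)
    (m : ℕ) : algebraTor k A M m N ≃ₗ[k] (C m →₀ M) := by
  let F := balancedTensorFunctor k A M
  let K := (F.mapHomologicalComplex _).obj P.complex
  have hK (i j : ℕ) : K.d i j = 0 := by
    obtain rfl | hij := eq_or_ne (j + 1) i
    · exact ModuleCat.hom_ext
        (BalancedTensor.map_eq_zero_of_forall_repr_smul_eq_zero (b j) (hP j))
    · exact K.shape _ _ hij
  let homologyIso : K.homology m ≅ F.obj (P.complex.X m) :=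
    (ShortComplex.LeftHomologyData.ofZeros (K.sc m) (hK _ _) (hK _ _)).homologyIso
  exact (P.isoLeftDerivedObj F m ≪≫ homologyIso).toLinearEquiv.trans
    (BalancedTensor.equivFinsupp k M (b m))

end Tor

section KoszulResolution

variable {k A ι : Type*} [Field k] [Ring A] [Algebra k A] [Fintype ι]
  {E : ι → ι → k} {x : ι → A}

variable (A E) in
/-- The basis of the term of degree `m` of the Koszul complex. -/
def koszulBasis (m : ℕ) : Module.Basis (koszulExponents E m) A (koszulModule A E m) :=
  .ofRepr (Finsupp.supportedEquivFinsupp _)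

instance (m : ℕ) : Module.Free A (koszulModule A E m) := .of_basis (koszulBasis A E m)

variable (E) in
/-- The augmentation of the Koszul complex onto the trivial module. -/
def koszulAugmentation (aug : A →ₐ[k] k) : koszulModule A E 0 →ₗ[A] TrivialModule aug :=
  LinearMap.toSpanSingleton A _ (show TrivialModule aug from (1 : k)) ∘ₗ
    Finsupp.lapply 0 ∘ₗ (koszulModule A E 0).subtype

lemma koszulAugmentation_apply (aug : A →ₐ[k] k) (z : koszulModule A E 0) :
    koszulAugmentation E aug z = (aug (z.1 0) : k) :=
  mul_one (aug (z.1 0) : k)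

lemma koszulAugmentation_surjective (aug : A →ₐ[k] k) :
    Function.Surjective (koszulAugmentation E aug) := by
  intro r
  have hmem : (0 : ι → ℕ) ∈ koszulExponents E 0 := by rw [koszulExponents_zero]; rfl
  refine ⟨⟨Finsupp.single 0 (algebraMap k A r), single_mem_koszulModule hmem _⟩, ?_⟩
  rw [koszulAugmentation_apply, Finsupp.single_eq_same]
  exact aug.commutes r

variable [LinearOrder ι]

variable (E x) in
/-- The differential of the Koszul complex between the terms of degrees `m + 1` and `m`. -/
def koszulDifferential (m : ℕ) : koszulModule A E (m + 1) →ₗ[A] koszulModule A E m :=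
  (koszulD E x).restrict fun _ => koszulD_mem_koszulModule

namespace IsSkewPolynomial

variable (h : IsSkewPolynomial E x)
include h

theorem exact_koszulDifferential (m : ℕ) :
    Function.Exact (koszulDifferential E x (m + 1)) (koszulDifferential E x m) := by
  rintro ⟨z, hz⟩
  constructor
  · intro hDz
    obtain ⟨y, hy, hyz⟩ := h.exists_koszulD_eq hz (congrArg Subtype.val hDz)
    exact ⟨⟨y, hy⟩, Subtype.ext hyz⟩
  · rintro ⟨y, hy⟩
    rw [← hy]
    exact Subtype.ext (koszulD_koszulD h.mul_swap h.toIsSkewCommuting y.1)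

theorem exact_koszulAugmentation {aug : A →ₐ[k] k} (haug : ∀ i, aug (x i) = 0) :
    Function.Exact (koszulDifferential E x 0) (koszulAugmentation E aug) := by
  rintro ⟨z, hz⟩
  constructor
  · intro hz0
    have hmem : z 0 ∈ RingHom.ker aug := (koszulAugmentation_apply aug ⟨z, hz⟩).symm.trans hz0
    obtain ⟨y, hy, hyz⟩ :=
      h.exists_koszulD_eq_of_apply_zero_mem (RingHom.ker_ne_top aug) haug hz hmem
    exact ⟨⟨y, hy⟩, Subtype.ext hyz⟩
  · rintro ⟨y, hy⟩
    rw [← hy, koszulAugmentation_apply]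
    exact koszulD_apply_mem (I := RingHom.ker aug) haug y.1 0

end IsSkewPolynomial

end KoszulResolution

namespace IsSkewPolynomial

variable {k : Type u} [Field k] {A : Type u} [Ring A] [Algebra k A] {ι : Type} [LinearOrder ι]
  [Fintype ι] {E : ι → ι → k} {x : ι → A} (h : IsSkewPolynomial E x) {aug : A →ₐ[k] k}
  (haug : ∀ i, aug (x i) = 0)

/-- The Koszul resolution of the trivial module over a skew polynomial algebra. -/
def koszulResolution : ProjectiveResolution (ModuleCat.of A (TrivialModule aug)) :=
  resolutionOfExact (K := fun m => koszulModule A E m) (d := koszulDifferential E x)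
    h.exact_koszulDifferential (h.exact_koszulAugmentation haug)
    (koszulAugmentation_surjective aug)

lemma koszulResolution_d (m : ℕ) : (h.koszulResolution haug).complex.d (m + 1) m =
    ModuleCat.ofHom (koszulDifferential E x m) :=
  complexOfExact_d (K := fun m => koszulModule A E m) h.exact_koszulDifferential m

/-- `Tor` of the trivial module: the differential of the Koszul resolution vanishes after
tensoring with the trivial module. -/
def algebraTorEquiv (m : ℕ) :
    algebraTor k A (TrivialModule aug) m (ModuleCat.of A (TrivialModule aug)) ≃ₗ[k]
      (koszulExponents E m →₀ k) :=
  let P := h.koszulResolution haug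
  let B (m : ℕ) : Module.Basis (koszulExponents E m) A (P.complex.X m) := koszulBasis A E m
  have hP (m : ℕ) (z : P.complex.X (m + 1)) (c : koszulExponents E m) (r : TrivialModule aug) :
      MulOpposite.op ((B m).repr (P.complex.d (m + 1) m z) c) • r = 0 := by
    rw [h.koszulResolution_d haug]
    have hker : aug (koszulD E x z.1 c) = 0 := koszulD_apply_mem (I := RingHom.ker aug) haug z.1 c
    exact (congrArg (· * (show k from r)) hker).trans (zero_mul _)
  algebraTorEquivFinsupp P B hP m

end IsSkewPolynomial

section Counting

variable {k ι : Type*} [Ring k] [Fintype ι] (E : ι → ι → k)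

open Classical in
/-- The Koszul exponents of degree `m` as a finite set of finitely supported functions. -/
def koszulExponentsEquiv (m : ℕ) : koszulExponents E m ≃
    ↥((Finset.finsuppAntidiag Finset.univ m).filter
      fun l : ι →₀ ℕ => ∀ i, E i i ≠ -1 → l i ≤ 1) :=
  (Finsupp.equivFunOnFinite.subtypeEquiv fun l => by
    simp [koszulExponents, Finset.mem_finsuppAntidiag, and_comm]).symm

instance (m : ℕ) : Finite (koszulExponents E m) :=
  .of_equiv _ (koszulExponentsEquiv E m).symm

open Classical in
lemma coeff_ite_inv_one_sub_X_one_add_X (p : Prop) (j : ℕ) :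
    PowerSeries.coeff j (if p then (1 - PowerSeries.X)⁻¹ else 1 + PowerSeries.X : PowerSeries ℚ) =
      if ¬p → j ≤ 1 then 1 else 0 := by
  by_cases h : p
  · have hgeom : ((1 - PowerSeries.X)⁻¹ : PowerSeries ℚ) = PowerSeries.mk 1 := by
      rw [PowerSeries.inv_eq_iff_mul_eq_one (by simp), PowerSeries.mk_one_mul_one_sub_eq_one]
    simp [h, hgeom]
  · rcases j with _ | _ | j <;> simp [h, PowerSeries.coeff_one, PowerSeries.coeff_X]

open Classical in
lemma mk_card_koszulExponents_eq_prod :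
    (PowerSeries.mk fun m => (Nat.card (koszulExponents E m) : ℚ)) =
      ∏ i, if E i i = -1 then (1 - PowerSeries.X)⁻¹ else 1 + PowerSeries.X := by
  ext m
  rw [PowerSeries.coeff_mk, PowerSeries.coeff_prod, Nat.card_congr (koszulExponentsEquiv E m),
    Nat.card_eq_fintype_card, Fintype.card_coe, Finset.card_filter, Nat.cast_sum]
  refine Finset.sum_congr rfl fun l _ => ?_
  simp only [coeff_ite_inv_one_sub_X_one_add_X, Finset.prod_ite_zero]
  simp

theorem mk_card_koszulExponents :
    (PowerSeries.mk fun m => (Nat.card (koszulExponents E m) : ℚ)) =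
      (1 + PowerSeries.X) ^ (Fintype.card ι - Nat.card {i // E i i = -1}) *
        ((1 - PowerSeries.X) ^ Nat.card {i // E i i = -1})⁻¹ := by
  classical
  have hodd : Nat.card {i // E i i = -1} = (Finset.univ.filter fun i => E i i = -1).card := by
    rw [Nat.card_eq_fintype_card, Fintype.card_subtype]
  have heven : Fintype.card ι - Nat.card {i // E i i = -1} =
      (Finset.univ.filter fun i => ¬E i i = -1).card := by
    rw [hodd, ← Finset.card_univ,
      ← Finset.card_filter_add_card_filter_not (s := Finset.univ) (fun i => E i i = -1),
      Nat.add_sub_cancel_left]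
  have hinv (r : ℕ) :
      ((1 - PowerSeries.X) ^ r)⁻¹ = ((1 - PowerSeries.X)⁻¹ : PowerSeries ℚ) ^ r := by
    rw [PowerSeries.inv_eq_iff_mul_eq_one (by simp), ← mul_pow,
      PowerSeries.inv_mul_cancel _ (by simp), one_pow]
  rw [mk_card_koszulExponents_eq_prod, Finset.prod_ite, Finset.prod_const, Finset.prod_const,
    hinv, heven, hodd, mul_comm]

lemma le_card_of_mem_koszulExponents (hE : ∀ i, E i i ≠ -1) {m : ℕ} {c : ι → ℕ}
    (hc : c ∈ koszulExponents E m) : m ≤ Fintype.card ι := by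
  rw [← hc.2, Fintype.card_eq_sum_ones]
  exact Finset.sum_le_sum fun i _ => hc.1 i (hE i)

open Classical in
lemma single_mem_koszulExponents {i : ι} (hi : E i i = -1) (m : ℕ) :
    Pi.single i m ∈ koszulExponents E m := by
  refine ⟨fun j hj => ?_, by simp⟩
  have hji : j ≠ i := by
    rintro rfl
    exact hj hi
  simp [hji]

theorem finite_sigma_koszulExponents_iff :
    Finite (Σ m, koszulExponents E m) ↔ ∀ i, E i i ≠ -1 := by
  classical
  constructor
  · intro hfin i hi
    exact not_finite_iff_infinite.2 (Infinite.of_injective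
      (fun m => (⟨m, _, single_mem_koszulExponents E hi m⟩ : Σ m, koszulExponents E m))
      fun _ _ hm => congrArg Sigma.fst hm) hfin
  · intro hE
    let f : (Σ m, koszulExponents E m) → Σ m : Fin (Fintype.card ι + 1), koszulExponents E m :=
      fun p => ⟨⟨p.1, Nat.lt_succ_of_le (le_card_of_mem_koszulExponents E hE p.2.2)⟩, p.2⟩
    refine Finite.of_injective f (Function.LeftInverse.injective (g := fun p => ⟨p.1, p.2⟩) ?_)
    exact fun _ => rfl

end Counting

lemma directSum_finite_iff_of_equiv_finsupp {k : Type*} [Field k] {C H : ℕ → Type*}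
    [∀ m, AddCommGroup (H m)] [∀ m, Module k (H m)]
    (e : ∀ m, H m ≃ₗ[k] (C m →₀ k)) :
    Module.Finite k (DirectSum ℕ H) ↔ Finite (Σ m, C m) := by
  let b : Module.Basis (Σ m, C m) k (DirectSum ℕ H) := DFinsupp.basis fun m => .ofRepr (e m)
  exact ⟨fun _ => Module.Finite.finite_basis b, fun _ => Module.Finite.of_basis b⟩

end

theorem mainTheorem4_general {k : Type u} [Field k] (hk2 : (2 : k) ≠ 0)
    {Γ : Type v} [AddCommGroup Γ] (ε : CommutationFactor k Γ)
    {g : Type u} [AddCommGroup g] [Module k g]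
    (L : ColorLieAlgebra ε g) (hL : L.IsAbelian)
    (n : ℕ) (b : Module.Basis (Fin n) k g) (deg : Fin n → Γ)
    (hb : ∀ i, b i ∈ L.component (deg i))
    (q : ℕ) (hq : q = Nat.card {i : Fin n // ε.val (deg i) (deg i) = -1}) :
    (∀ i, Module.Finite k (L.homology i)) ∧
    L.poincareSeries = (1 + PowerSeries.X) ^ (n - q) * ((1 - PowerSeries.X) ^ q)⁻¹ ∧
    (Module.Finite k (DirectSum ℕ fun i => L.homology i) ↔ q = 0) := by
  let E (i j : Fin n) : k := ε.val (deg i) (deg j)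
  have hx : IsSkewPolynomial E fun i => L.toEnveloping (b i) :=
    ColorLieAlgebra.isSkewPolynomial_toEnveloping b hb hk2 hL
  let e (m : ℕ) : L.homology m ≃ₗ[k] (koszulExponents E m →₀ k) :=
    hx.algebraTorEquiv (fun i => L.augmentation_toEnveloping (b i)) m
  have hdim (m : ℕ) : Module.finrank k (L.homology m) = Nat.card (koszulExponents E m) := by
    rw [(e m).finrank_eq, Module.finrank_eq_nat_card_basis Finsupp.basisSingleOne]
  refine ⟨fun m => .equiv (e m).symm, ?_, ?_⟩
  · have hcount := mk_card_koszulExponents E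
    rw [Fintype.card_fin, ← hq] at hcount
    simpa only [ColorLieAlgebra.poincareSeries, hdim] using hcount
  · rw [directSum_finite_iff_of_equiv_finsupp e, finite_sigma_koszulExponents_iff, hq,
      Finite.card_eq_zero_iff, isEmpty_subtype]

theorem mainTheorem4 {k : Type u} [Field k] (hk2 : (2 : k) ≠ 0) (hk3 : (3 : k) ≠ 0)
    {Γ : Type v} [AddCommGroup Γ] (ε : CommutationFactor k Γ)
    {g : Type u} [AddCommGroup g] [Module k g]
    (L : ColorLieAlgebra ε g) (hL : L.IsAbelian)
    (n : ℕ) (b : Module.Basis (Fin n) k g) (deg : Fin n → Γ)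
    (hb : ∀ i, b i ∈ L.component (deg i))
    (q : ℕ) (hq : q = Nat.card {i : Fin n // ε.val (deg i) (deg i) = -1}) :
    (∀ i, Module.Finite k (L.homology i)) ∧
    L.poincareSeries = (1 + PowerSeries.X) ^ (n - q) * ((1 - PowerSeries.X) ^ q)⁻¹ ∧
    (Module.Finite k (DirectSum ℕ fun i => L.homology i) ↔ q = 0) :=
  mainTheorem4_general hk2 ε L hL n b deg hb q hq
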